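/- A \emph{$1$-bend right-angle-crossing drawing} ($\mathrm{RAC}_1$ drawing) of a finite simple graph $G$ is a polyline drawing of $G$ in the Euclidean plane (vertices are distinct points; each edge is a simple polygonal arc that joins its two endpoints and passes through no other vertex) in which each edge has at most one bend, and in which any common point of two distinct edges other than a vertex is a crossing point that is interior to a straight segment of each of the two edges, these two segments being perpendicular. A graph that admits such a drawing is called a $\mathrm{RAC}_1$ graph. \textbf{Theorem.} There are infinitely many positive integers $n$ for which there exists an $n$-vertex $\mathrm{RAC}_1$ graph with exactly $5n-10$ edges. -/

import Mathlib

/-- The Euclidean plane. -/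
abbrev Plane : Type := EuclideanSpace ℝ (Fin 2)

/-- The pairs of endpoints of the straight segments of the polygonal chain with the given
corners, in order. -/
def chainSegments (l : List Plane) : List (Plane × Plane) := l.zip l.tail

/-- The polygonal chain with the given corners is a simple arc: its segments are nondegenerate,
and a point on two different segments can only be the end of the earlier and the start of the
later one. (With nondegenerate segments, this forces the two to be consecutive.) -/
def IsSimpleChain (l : List Plane) : Prop :=
  (∀ s ∈ chainSegments l, s.1 ≠ s.2) ∧
  (chainSegments l).Pairwise fun s t =>
    ∀ p ∈ segment ℝ s.1 s.2, p ∈ segment ℝ t.1 t.2 → p = s.2 ∧ p = t.1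

/-- A polyline drawing of a graph: vertices are distinct points of the plane, and every edge is a
simple polygonal chain that joins its two endpoints and passes through no other vertex. -/
structure PolylineDrawing {V : Type*} (G : SimpleGraph V) where
  /-- The point that represents a vertex. -/
  pos : V → Plane
  pos_injective : Function.Injective pos
  /-- The corners of the chain that represents an edge: the two endpoints, with the bends
  between them. The direction in which the edge is listed is immaterial. -/
  chain : G.edgeSet → List Plane
  chain_joins : ∀ e : G.edgeSet, ∃ (u v : V) (bends : List Plane),
    (e : Sym2 V) = s(u, v) ∧ chain e = pos u :: (bends ++ [pos v])
  chain_simple : ∀ e : G.edgeSet, IsSimpleChain (chain e)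
  chain_avoids : ∀ (e : G.edgeSet) (w : V), ∀ s ∈ chainSegments (chain e),
    pos w ∈ segment ℝ s.1 s.2 → w ∈ (e : Sym2 V)

namespace PolylineDrawing

variable {V : Type*} {G : SimpleGraph V}

/-- Every edge has at most `k` bends. -/
def HasAtMostBends (Γ : PolylineDrawing G) (k : ℕ) : Prop :=
  ∀ e : G.edgeSet, (Γ.chain e).length ≤ k + 2

/-- All crossings are at right angles: whenever two segments of two distinct edges have a common
point that is not a vertex, this point is interior to both segments (so it is not a bend), and
the segments are perpendicular. -/
def CrossesAtRightAngles (Γ : PolylineDrawing G) : Prop :=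
  ∀ e f : G.edgeSet, e ≠ f →
    ∀ s ∈ chainSegments (Γ.chain e), ∀ t ∈ chainSegments (Γ.chain f),
      ∀ p ∈ segment ℝ s.1 s.2, p ∈ segment ℝ t.1 t.2 → (∀ w : V, p ≠ Γ.pos w) →
        p ∈ openSegment ℝ s.1 s.2 ∧ p ∈ openSegment ℝ t.1 t.2 ∧
          inner ℝ (s.2 - s.1) (t.2 - t.1) = 0

end PolylineDrawing

/-- `G` is a `k`-bend right-angle-crossing graph: it admits a polyline drawing in which every edge
has at most `k` bends and all crossings are at right angles. -/
def IsRACGraph {V : Type*} (k : ℕ) (G : SimpleGraph V) : Prop :=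
  ∃ Γ : PolylineDrawing G, Γ.HasAtMostBends k ∧ Γ.CrossesAtRightAngles

/-! Take a plane graph on n vertices all of whose faces are pentagons. By Euler's formula it has
5(n-2)/3 edges and 2(n-2)/3 faces. Adding the five diagonals of every face, the outer one included,
contributes 10(n-2)/3 more edges, which makes 5n-10 in total. It remains to find infinitely many
such graphs whose diagonals can be drawn with one bend each, inside their faces, so that all
crossings are at right angles.

The graphs are towers of dodecahedra. A layer is a dodecahedron drawn between an outer pentagon and
an inner one, where the inner pentagon is the outer one scaled by -1/10. The next layer, the same
picture scaled by -1/10, therefore fits exactly into the inner pentagon. With N layers there are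
15N+5 vertices and 10N+2 pentagonal faces. Each layer owns 75 arcs: 25 sides, without those of its
inner pentagon, and 50 diagonals of its ten faces between the two pentagons. The outermost pentagon
adds 5 exterior diagonals, and the innermost one adds its 5 sides and 5 diagonals. For N > 0 this
gives 75N+15 = 5(15N+5)-10 edges.

One layer is a finite object with integer coordinates, so signs of orientations and dot products
certify all its incidences and the kernel evaluates them. Arcs of different levels are separated by
convexity: the deeper arc runs in the inner pentagon of the other arc's layer
(`inPentagon_of_mem_segment`, `inPentagon_of_smul_eq`), and the other arc meets that pentagon only
in its own endpoints (`eq_end_of_mem_segment`). -/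

/-! ### Integer points and segments between them -/

/-- A point of the plane with integer coordinates. -/
abbrev IntPoint : Type := ℤ × ℤ

/-- The point of the Euclidean plane with the given integer coordinates. -/
noncomputable def IntPoint.toPlane (z : IntPoint) : Plane := !₂[(z.1 : ℝ), (z.2 : ℝ)]

namespace IntPoint

@[simp] lemma toPlane_zero (z : IntPoint) : z.toPlane 0 = z.1 := rfl

@[simp] lemma toPlane_one (z : IntPoint) : z.toPlane 1 = z.2 := rfl

lemma toPlane_injective : Function.Injective toPlane := by
  intro a b h
  have h0 : (a.1 : ℝ) = b.1 := congrArg (fun p : Plane => p 0) h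
  have h1 : (a.2 : ℝ) = b.2 := congrArg (fun p : Plane => p 1) h
  exact Prod.ext (by exact_mod_cast h0) (by exact_mod_cast h1)

/-- Twice the signed area of the triangle `abc`. -/
def orient (a b c : IntPoint) : ℤ := (b.1 - a.1) * (c.2 - a.2) - (b.2 - a.2) * (c.1 - a.1)

/-- The inner product of the vectors `ab` and `cd`. -/
def dot (a b c d : IntPoint) : ℤ := (b.1 - a.1) * (d.1 - c.1) + (b.2 - a.2) * (d.2 - c.2)

end IntPoint

open IntPoint

/-! ### Sign tests for segments by signed areas -/

lemma mem_segment_plane_iff {x y p : Plane} :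
    p ∈ segment ℝ x y ↔ ∃ θ : ℝ, 0 ≤ θ ∧ θ ≤ 1 ∧
      p 0 = x 0 + θ * (y 0 - x 0) ∧ p 1 = x 1 + θ * (y 1 - x 1) := by
  rw [segment_eq_image']
  constructor
  · rintro ⟨θ, ⟨h0, h1⟩, rfl⟩
    exact ⟨θ, h0, h1, by simp, by simp⟩
  · rintro ⟨θ, h0, h1, e0, e1⟩
    refine ⟨θ, ⟨h0, h1⟩, ?_⟩
    ext i
    fin_cases i
    · simp [e0]
    · simp [e1]

/-- The signed area function of a line, as a function on the whole plane. -/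
noncomputable def lineForm (a b : IntPoint) (p : Plane) : ℝ :=
  (b.1 - a.1) * (p 1 - a.2) - (b.2 - a.2) * (p 0 - a.1)

lemma lineForm_toPlane (a b c : IntPoint) : lineForm a b c.toPlane = orient a b c := by
  simp [lineForm, orient]

lemma lineForm_eq_zero {a b : IntPoint} {p : Plane}
    (hp : p ∈ segment ℝ a.toPlane b.toPlane) : lineForm a b p = 0 := by
  obtain ⟨θ, -, -, e0, e1⟩ := mem_segment_plane_iff.1 hp
  simp only [toPlane_zero, toPlane_one] at e0 e1
  rw [lineForm, e0, e1]
  ring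

lemma lineForm_of_mem_segment {a b c d : IntPoint} {p : Plane}
    (hp : p ∈ segment ℝ c.toPlane d.toPlane) : ∃ θ : ℝ, 0 ≤ θ ∧ θ ≤ 1 ∧
      lineForm a b p = (1 - θ) * orient a b c + θ * orient a b d ∧
      (θ = 0 → p = c.toPlane) := by
  obtain ⟨θ, h0, h1, e0, e1⟩ := mem_segment_plane_iff.1 hp
  simp only [toPlane_zero, toPlane_one] at e0 e1
  refine ⟨θ, h0, h1, ?_, ?_⟩
  · rw [lineForm, e0, e1]
    push_cast [orient]
    ring
  · rintro rfl
    ext i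
    fin_cases i
    · simpa using e0
    · simpa using e1

/-- The affine form of the line `ab` vanishes on one segment and has a constant nonzero sign on the
other. -/
lemma not_mem_segment_of_same_side {a b c d : IntPoint}
    (h : 0 < orient a b c * orient a b d) {p : Plane}
    (hp : p ∈ segment ℝ a.toPlane b.toPlane) : p ∉ segment ℝ c.toPlane d.toPlane := by
  intro hq
  obtain ⟨θ, h0, h1, e, -⟩ := lineForm_of_mem_segment (a := a) (b := b) hq
  rw [lineForm_eq_zero hp] at e
  rcases pos_and_pos_or_neg_and_neg_of_mul_pos h with ⟨hc, hd⟩ | ⟨hc, hd⟩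
  · have hc' : (0 : ℝ) < orient a b c := by exact_mod_cast hc
    have hd' : (0 : ℝ) < orient a b d := by exact_mod_cast hd
    rcases h0.eq_or_lt with rfl | h0
    · simp at e; linarith
    · nlinarith [mul_pos h0 hd', mul_nonneg (sub_nonneg.2 h1) hc'.le]
  · have hc' : (orient a b c : ℝ) < 0 := by exact_mod_cast hc
    have hd' : (orient a b d : ℝ) < 0 := by exact_mod_cast hd
    rcases h0.eq_or_lt with rfl | h0
    · simp at e; linarith
    · nlinarith [mul_pos h0 (neg_pos.2 hd'), mul_nonneg (sub_nonneg.2 h1) (neg_pos.2 hc').le]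

lemma eq_of_mem_segments {a b d : IntPoint} (h : orient a b d ≠ 0) {p : Plane}
    (hp : p ∈ segment ℝ a.toPlane b.toPlane) (hq : p ∈ segment ℝ a.toPlane d.toPlane) :
    p = a.toPlane := by
  obtain ⟨θ, h0, h1, e, h⟩ := lineForm_of_mem_segment (a := a) (b := b) hq
  rw [lineForm_eq_zero hp] at e
  have ha : orient a b a = 0 := by simp [orient]
  rw [ha] at e
  simp only [Int.cast_zero, mul_zero, zero_add, zero_eq_mul, Int.cast_eq_zero] at e
  -- Along `ad` the form is θ times `orient a b d`, so θ = 0; `‹_›` is the nonvanishing hypothesis,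
  -- shadowed by the `obtain`.
  exact h (e.resolve_right ‹_›)

lemma ne_toPlane_of_orient_ne {c d a : IntPoint} (h : orient c d a ≠ 0) {p : Plane}
    (hp : p ∈ segment ℝ c.toPlane d.toPlane) : p ≠ a.toPlane := by
  rintro rfl
  have := lineForm_eq_zero hp
  rw [lineForm_toPlane] at this
  exact h (by exact_mod_cast this)

lemma mem_openSegment_of_orient_ne {a b c d : IntPoint} (ha : orient c d a ≠ 0)
    (hb : orient c d b ≠ 0) {p : Plane} (hp : p ∈ segment ℝ a.toPlane b.toPlane)
    (hq : p ∈ segment ℝ c.toPlane d.toPlane) : p ∈ openSegment ℝ a.toPlane b.toPlane :=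
  mem_openSegment_of_ne_left_right (ne_toPlane_of_orient_ne ha hq).symm
    (ne_toPlane_of_orient_ne hb hq).symm hp

lemma inner_toPlane_sub (a b c d : IntPoint) :
    inner ℝ (b.toPlane - a.toPlane) (d.toPlane - c.toPlane) = (dot a b c d : ℝ) := by
  rw [PiLp.inner_apply, Fin.sum_univ_two]
  simp only [PiLp.sub_apply, toPlane_zero, toPlane_one, RCLike.inner_apply, conj_trivial]
  push_cast [dot]
  ring

/-! ### Scaling -/

lemma smul_mem_openSegment {c : ℝ} {x y p : Plane} (hp : p ∈ openSegment ℝ x y) :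
    c • p ∈ openSegment ℝ (c • x) (c • y) := by
  obtain ⟨a, b, ha, hb, hab, rfl⟩ := hp
  exact ⟨a, b, ha, hb, hab, by module⟩

lemma exists_smul_of_mem_segment_smul {c : ℝ} {x y p : Plane}
    (hp : p ∈ segment ℝ (c • x) (c • y)) : ∃ q ∈ segment ℝ x y, p = c • q := by
  obtain ⟨a, b, ha, hb, hab, rfl⟩ := hp
  exact ⟨a • x + b • y, ⟨a, b, ha, hb, hab, rfl⟩, by module⟩

lemma chainSegments_map (f : Plane → Plane) (l : List Plane) :
    chainSegments (l.map f) = (chainSegments l).map (Prod.map f f) := by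
  rw [chainSegments, ← List.map_tail, List.zip_map]
  rfl

lemma IsSimpleChain.smul {c : ℝ} (hc : c ≠ 0) {l : List Plane} (hl : IsSimpleChain l) :
    IsSimpleChain (l.map (c • ·)) := by
  rw [IsSimpleChain, chainSegments_map]
  refine ⟨?_, ?_⟩
  · simp only [List.mem_map, forall_exists_index, and_imp]
    rintro _ s hs rfl
    exact (smul_right_injective _ hc).ne (hl.1 s hs)
  · rw [List.pairwise_map]
    refine hl.2.imp ?_
    intro s t h p hp hq
    obtain ⟨q, hq', rfl⟩ := exists_smul_of_mem_segment_smul hp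
    obtain ⟨r, hr, e⟩ := exists_smul_of_mem_segment_smul hq
    obtain rfl := smul_right_injective _ hc e
    obtain ⟨h1, h2⟩ := h q hq' hr
    exact ⟨congrArg _ h1, congrArg _ h2⟩

/-! ### Arcs with integer corners -/

/-- A polygonal arc with integer corners between two of the numbered vertices. -/
structure IntArc where
  /-- The first endpoint. -/
  src : ℕ
  /-- The last endpoint. -/
  tgt : ℕ
  /-- The bends. -/
  bends : List IntPoint

namespace IntArc

variable (f : ℕ → IntPoint)

/-- The corners of an arc. -/
def corners (a : IntArc) : List IntPoint := f a.src :: (a.bends ++ [f a.tgt])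

/-- The segments of an arc. -/
def segments (a : IntArc) : List (IntPoint × IntPoint) :=
  (a.corners f).zip (a.corners f).tail

lemma chainSegments_corners (a : IntArc) :
    chainSegments ((a.corners f).map toPlane) =
      (a.segments f).map (Prod.map toPlane toPlane) := by
  rw [chainSegments, ← List.map_tail, List.zip_map, segments]

/-- A point is an endpoint of the arc. -/
def isEnd (a : IntArc) (z : IntPoint) : Bool := z == f a.src || z == f a.tgt

lemma isEnd_iff {f : ℕ → IntPoint} {a : IntArc} {z : IntPoint} :
    a.isEnd f z = true ↔ z = f a.src ∨ z = f a.tgt := by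
  simp [isEnd]

/-- Certificate that an arc with at most one bend is simple. -/
def simpleCheck (a : IntArc) : Bool :=
  match a.corners f with
  | [x, y] => x != y
  | [x, y, z] => orient y x z != 0
  | _ => false

lemma isSimpleChain_of_simpleCheck {f : ℕ → IntPoint} {a : IntArc} (h : a.simpleCheck f = true) :
    IsSimpleChain ((a.corners f).map toPlane) ∧ (a.corners f).length ≤ 3 := by
  rw [simpleCheck] at h
  split at h
  · next x y e =>
    rw [e]
    simp only [bne_iff_ne] at h
    refine ⟨⟨?_, ?_⟩, by simp⟩
    · simpa [chainSegments] using toPlane_injective.ne h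
    · simp [chainSegments]
  · next x y z e =>
    rw [e]
    simp only [bne_iff_ne] at h
    have hyx : y ≠ x := by rintro rfl; simp [orient] at h
    have hyz : y ≠ z := by
      rintro rfl
      apply h
      simp [orient]
    refine ⟨⟨?_, ?_⟩, by simp⟩
    · simpa [chainSegments] using ⟨toPlane_injective.ne hyx.symm, toPlane_injective.ne hyz⟩
    · simp only [chainSegments, List.map_cons, List.map_nil, List.tail_cons, List.zip_cons_cons,
        List.zip_nil_right, List.pairwise_cons, List.mem_singleton, forall_eq,
        List.not_mem_nil, false_imp_iff, implies_true, List.Pairwise.nil, and_true, and_self]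
      intro p hp hq
      rw [segment_symm] at hp
      exact eq_of_mem_segments h hp hq
  · exact absurd h (by simp)

/-- Certificate that two segments of different arcs are disjoint, or cross at a right angle, or
share just an endpoint of the arcs. -/
def segmentCheck (a : IntArc) (s t : IntPoint × IntPoint) : Bool :=
  decide (0 < orient s.1 s.2 t.1 * orient s.1 s.2 t.2) ||
  decide (0 < orient t.1 t.2 s.1 * orient t.1 t.2 s.2) ||
  (decide (orient s.1 s.2 t.1 * orient s.1 s.2 t.2 < 0) &&
    decide (orient t.1 t.2 s.1 * orient t.1 t.2 s.2 < 0) && dot s.1 s.2 t.1 t.2 == 0) ||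
  (s.1 == t.1 && a.isEnd f s.1 && orient s.1 s.2 t.2 != 0) ||
  (s.1 == t.2 && a.isEnd f s.1 && orient s.1 s.2 t.1 != 0) ||
  (s.2 == t.1 && a.isEnd f s.2 && orient s.2 s.1 t.2 != 0) ||
  (s.2 == t.2 && a.isEnd f s.2 && orient s.2 s.1 t.1 != 0)

/-- The segments meet only in an endpoint of the first arc or at a right angle. -/
def MeetRight (a : IntArc) (s t : IntPoint × IntPoint) : Prop :=
  ∀ p ∈ segment ℝ s.1.toPlane s.2.toPlane, p ∈ segment ℝ t.1.toPlane t.2.toPlane →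
    (p = (f a.src).toPlane ∨ p = (f a.tgt).toPlane) ∨
    (p ∈ openSegment ℝ s.1.toPlane s.2.toPlane ∧ p ∈ openSegment ℝ t.1.toPlane t.2.toPlane ∧
      inner ℝ (s.2.toPlane - s.1.toPlane) (t.2.toPlane - t.1.toPlane) = 0)

/-- The first two alternatives make the segments disjoint. In the third, no endpoint of either
segment lies on the line of the other, so a common point is interior to both. In the last four, a
shared corner that is an end of the arc is the only common point, because the segments are not
collinear. -/
lemma meetRight_of_segmentCheck {f : ℕ → IntPoint} {a : IntArc} {s t : IntPoint × IntPoint}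
    (h : a.segmentCheck f s t = true) : a.MeetRight f s t := by
  obtain ⟨x, y⟩ := s
  obtain ⟨z, w⟩ := t
  intro p hp hq
  have key : ∀ v : IntPoint, a.isEnd f v = true → p = v.toPlane →
      p = (f a.src).toPlane ∨ p = (f a.tgt).toPlane := by
    intro v hv e
    rcases isEnd_iff.1 hv with rfl | rfl
    · exact Or.inl e
    · exact Or.inr e
  simp only [segmentCheck, Bool.or_eq_true, Bool.and_eq_true, decide_eq_true_eq, beq_iff_eq,
    bne_iff_ne] at h
  dsimp only at hp hq ⊢
  rcases h with (((((h | h) | ⟨⟨h1, h2⟩, h3⟩) | ⟨⟨rfl, h1⟩, h2⟩) | ⟨⟨rfl, h1⟩, h2⟩) |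
    ⟨⟨rfl, h1⟩, h2⟩) | ⟨⟨rfl, h1⟩, h2⟩
  · exact absurd hq (not_mem_segment_of_same_side h hp)
  · exact absurd hp (not_mem_segment_of_same_side h hq)
  · have n1 := left_ne_zero_of_mul h1.ne
    have n2 := right_ne_zero_of_mul h1.ne
    have n3 := left_ne_zero_of_mul h2.ne
    have n4 := right_ne_zero_of_mul h2.ne
    refine Or.inr ⟨mem_openSegment_of_orient_ne n3 n4 hp hq,
      mem_openSegment_of_orient_ne n1 n2 hq hp, ?_⟩
    rw [inner_toPlane_sub, h3, Int.cast_zero]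
  · exact Or.inl (key _ h1 (eq_of_mem_segments h2 hp hq))
  · rw [segment_symm ℝ z.toPlane] at hq
    exact Or.inl (key _ h1 (eq_of_mem_segments h2 hp hq))
  · rw [segment_symm ℝ x.toPlane] at hp
    exact Or.inl (key _ h1 (eq_of_mem_segments h2 hp hq))
  · rw [segment_symm ℝ x.toPlane] at hp
    rw [segment_symm ℝ z.toPlane] at hq
    exact Or.inl (key _ h1 (eq_of_mem_segments h2 hp hq))

/-- Certificate that any two arcs of a list meet at right angles or at common vertices. -/
def pairsCheck : List IntArc → Bool
  | [] => true
  | a :: l => l.all (fun b => (a.segments f).all fun s => (b.segments f).all fun t =>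
      a.segmentCheck f s t) && pairsCheck l

lemma meetRight_of_pairsCheck {f : ℕ → IntPoint} {l : List IntArc} (h : pairsCheck f l = true) :
    l.Pairwise fun a b => ∀ s ∈ a.segments f, ∀ t ∈ b.segments f, a.MeetRight f s t := by
  induction l with
  | nil => exact List.Pairwise.nil
  | cons a l ih =>
    simp only [pairsCheck, Bool.and_eq_true, List.all_eq_true] at h
    exact List.Pairwise.cons
      (fun b hb s hs t ht => meetRight_of_segmentCheck (h.1 b hb s hs t ht)) (ih h.2)

/-- Certificate that a point is not on a segment. -/
def avoidCheck (z : IntPoint) (s : IntPoint × IntPoint) : Bool :=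
  orient s.1 s.2 z != 0 || decide (dot s.1 z s.1 s.2 < 0) || decide (dot s.2 z s.2 s.1 < 0)

lemma not_mem_segment_of_avoidCheck {z : IntPoint} {s : IntPoint × IntPoint}
    (h : avoidCheck z s = true) : z.toPlane ∉ segment ℝ s.1.toPlane s.2.toPlane := by
  obtain ⟨x, y⟩ := s
  intro hz
  simp only [avoidCheck, Bool.or_eq_true, decide_eq_true_eq, bne_iff_ne] at h
  dsimp only at hz
  obtain ⟨θ, h0, h1, e0, e1⟩ := mem_segment_plane_iff.1 hz
  simp only [toPlane_zero, toPlane_one] at e0 e1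
  rcases h with (h | h) | h
  · exact ne_toPlane_of_orient_ne h hz rfl
  · have h' : ((dot x z x y : ℤ) : ℝ) < 0 := by exact_mod_cast h
    push_cast [dot] at h'
    rw [e0, e1] at h'
    -- At parameter θ the dot product equals θ times the squared length of the segment, hence is
    -- nonnegative.
    nlinarith [mul_nonneg h0 (add_nonneg (sq_nonneg ((y.1 : ℝ) - x.1)) (sq_nonneg ((y.2 : ℝ) - x.2)))]
  · have h' : ((dot y z y x : ℤ) : ℝ) < 0 := by exact_mod_cast h
    push_cast [dot] at h'
    rw [e0, e1] at h'
    nlinarith [mul_nonneg (sub_nonneg.2 h1)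
      (add_nonneg (sq_nonneg ((y.1 : ℝ) - x.1)) (sq_nonneg ((y.2 : ℝ) - x.2)))]

end IntArc

/-! ### Integer linear forms -/

/-- An affine form with integer coefficients: `((a, b), c)` stands for `a x + b y - c`. -/
abbrev IntForm : Type := IntPoint × ℤ

namespace IntForm

/-- The linear part of the form on the integer points. -/
def linear (ℓ : IntForm) (z : IntPoint) : ℤ := ℓ.1.1 * z.1 + ℓ.1.2 * z.2

/-- The linear part of the form. -/
noncomputable def linearR (ℓ : IntForm) (p : Plane) : ℝ := ℓ.1.1 * p 0 + ℓ.1.2 * p 1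

lemma linearR_toPlane (ℓ : IntForm) (z : IntPoint) : ℓ.linearR z.toPlane = ℓ.linear z := by
  simp [linearR, linear]

lemma linearR_smul (ℓ : IntForm) (c : ℝ) (p : Plane) : ℓ.linearR (c • p) = c * ℓ.linearR p := by
  simp only [linearR, PiLp.smul_apply, smul_eq_mul]
  ring

lemma linearR_of_mem_segment (ℓ : IntForm) {z w : IntPoint} {p : Plane}
    (hp : p ∈ segment ℝ z.toPlane w.toPlane) : ∃ θ : ℝ, 0 ≤ θ ∧ θ ≤ 1 ∧
      ℓ.linearR p = (1 - θ) * ℓ.linear z + θ * ℓ.linear w ∧ (θ = 0 → p = z.toPlane) := by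
  obtain ⟨θ, h0, h1, e0, e1⟩ := mem_segment_plane_iff.1 hp
  simp only [toPlane_zero, toPlane_one] at e0 e1
  refine ⟨θ, h0, h1, ?_, ?_⟩
  · rw [linearR, e0, e1]
    push_cast [linear]
    ring
  · rintro rfl
    ext i
    fin_cases i
    · simpa using e0
    · simpa using e1

end IntForm

/-- The vertices of a layer: the outer pentagon (0 to 4), the inner vertices (5 to 14), and the
inner pentagon (15 to 19). -/
def layerVertices : List IntPoint :=
  [(33150000, 0), (10276500, 31492500), (-26851500, 19558500), (-26851500, -19558500),
   (10276500, -31492500), (12066600, -6364800), (9779250, 9514050), (-6033300, 12265500),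
   (-13525200, -1955850), (-2320500, -13458900), (8519550, -828750), (3414450, 7856550),
   (-6397950, 5668650), (-7392450, -4342650), (1856400, -8353800), (-3315000, 0),
   (-1027650, -3149250), (2685150, -1955850), (2685150, 1955850), (-1027650, 3149250)]

/-- The vertex of a layer with the given number. -/
def layerVertex (i : ℕ) : IntPoint := layerVertices.getD i 0

/-- The sides of the pentagons of a layer, without those of its inner pentagon, and the diagonals
of the pentagons. -/
def layerArcs : List IntArc :=
  [⟨0, 1, []⟩, ⟨0, 5, []⟩, ⟨5, 10, []⟩, ⟨6, 10, []⟩, ⟨10, 18, []⟩,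
   ⟨1, 5, [(10322910, 30252690)]⟩, ⟨0, 6, [(14652300, 9746100)]⟩, ⟨1, 10, [(11808150, -672150)]⟩,
   ⟨5, 6, [(10382580, -3155880)]⟩, ⟨0, 10, [(9272055, -1137045)]⟩, ⟨6, 18, [(7508475, 4849845)]⟩,
   ⟨10, 11, [(8536125, -679575)]⟩, ⟨6, 19, [(-895050, 3109470)]⟩, ⟨11, 18, [(865215, 4989075)]⟩,
   ⟨10, 19, [(4237350, 6308250)]⟩, ⟨1, 2, []⟩, ⟨1, 6, []⟩, ⟨6, 11, []⟩, ⟨7, 11, []⟩,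
   ⟨11, 19, []⟩, ⟨2, 6, [(-26394030, 19687785)]⟩, ⟨1, 7, [(-4720560, 16933020)]⟩,
   ⟨2, 11, [(4245780, 10812390)]⟩, ⟨6, 7, [(5529420, 9013485)]⟩, ⟨1, 11, [(3682965, 8048820)]⟩,
   ⟨7, 19, [(-2214420, 8489715)]⟩, ⟨11, 12, [(3238755, 7810140)]⟩, ⟨7, 15, [(-3315000, 33150)]⟩,
   ⟨12, 19, [(-4369170, 2406690)]⟩, ⟨11, 15, [(-4662060, 6061770)]⟩, ⟨2, 3, []⟩, ⟨2, 7, []⟩,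
   ⟨7, 12, []⟩, ⟨8, 12, []⟩, ⟨12, 15, []⟩, ⟨3, 7, [(-26569725, -18017025)]⟩,
   ⟨2, 8, [(-17562870, 782340)]⟩, ⟨3, 12, [(-8689530, 7222710)]⟩, ⟨7, 8, [(-6679725, 8138325)]⟩,
   ⟨2, 12, [(-6951555, 6063135)]⟩, ⟨8, 15, [(-8711820, 510510)]⟩,
   ⟨12, 13, [(-6464250, 5469750)]⟩, ⟨8, 16, [(-1505010, -3092895)]⟩,
   ⟨13, 15, [(-3639870, -3434340)]⟩, ⟨12, 16, [(-7177050, -2567550)]⟩, ⟨3, 4, []⟩, ⟨3, 8, []⟩,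
   ⟨8, 13, []⟩, ⟨9, 13, []⟩, ⟨13, 16, []⟩, ⟨4, 8, [(9258795, -31025085)]⟩,
   ⟨3, 9, [(-6122805, -16439085)]⟩, ⟨4, 13, [(-9629100, -6095700)]⟩,
   ⟨8, 9, [(-9722895, -4014465)]⟩, ⟨3, 13, [(-7717320, -4561440)]⟩,
   ⟨9, 16, [(-3232125, -8138325)]⟩, ⟨13, 14, [(-6838845, -4511715)]⟩,
   ⟨9, 17, [(2529345, -2482935)]⟩, ⟨14, 16, [(1965795, -4471935)]⟩,
   ⟨13, 17, [(156630, -7678290)]⟩, ⟨0, 4, []⟩, ⟨4, 9, []⟩, ⟨9, 14, []⟩, ⟨5, 14, []⟩,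
   ⟨14, 17, []⟩, ⟨0, 9, [(32112405, -1306110)]⟩, ⟨4, 5, [(13697580, -10985910)]⟩,
   ⟨0, 14, [(2700960, -10746720)]⟩, ⟨5, 9, [(513825, -10442250)]⟩,
   ⟨4, 14, [(2300610, -8894145)]⟩, ⟨5, 17, [(6842160, -5675280)]⟩,
   ⟨10, 14, [(1926015, -8197995)]⟩, ⟨5, 18, [(3311685, 1468545)]⟩, ⟨10, 17, [(4882995, 500565)]⟩,
   ⟨14, 18, [(7347978, -2216154)]⟩]

/-- The diagonals of the outer pentagon, drawn in its exterior. -/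
def outerArcs : List IntArc :=
  [⟨1, 4, [(199231500, 0)]⟩, ⟨0, 2, [(68040375, 209342250)]⟩, ⟨1, 3, [(-166081500, 119671500)]⟩,
   ⟨2, 4, [(-166081500, -119671500)]⟩, ⟨0, 3, [(68040375, -209342250)]⟩]

/-- The sides and the diagonals of the outer pentagon, drawn in its interior. -/
def innerArcs : List IntArc :=
  [⟨1, 4, [(5027750, 0)]⟩, ⟨0, 2, [(1823250, 5221125)]⟩, ⟨1, 3, [(-3646500, 3646500)]⟩,
   ⟨2, 4, [(-3646500, -3646500)]⟩, ⟨0, 3, [(1823250, -5221125)]⟩, ⟨0, 1, []⟩, ⟨1, 2, []⟩,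
   ⟨2, 3, []⟩, ⟨3, 4, []⟩, ⟨0, 4, []⟩]

/-- The sides of the outer pentagon. -/
def pentagonSides : List IntForm :=
  [((95, 69), 3149250000), ((-9, 28), 789301500), ((-1, 0), 26851500), ((-9, -28), 789301500),
   ((95, -69), 3149250000)]

/-! ### Verification of the finitely many incidences of a layer -/

lemma simpleCheck_arcs :
    (layerArcs ++ outerArcs ++ innerArcs).all (·.simpleCheck layerVertex) = true := by
  decide +kernel

/-- The two lists are tested jointly because they coexist at level 0; deeper layers use a sublist.
-/
lemma pairsCheck_layerArcs_outerArcs :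
    IntArc.pairsCheck layerVertex (layerArcs ++ outerArcs) = true := by
  decide +kernel

lemma pairsCheck_innerArcs : IntArc.pairsCheck layerVertex innerArcs = true := by
  decide +kernel

/-- Certificate that arcs avoid the first `n` vertices, their own endpoints excepted. -/
def avoidsCheck (n : ℕ) (l : List IntArc) : Bool :=
  l.all fun a => (List.range n).all fun i => i == a.src || i == a.tgt ||
    (a.segments layerVertex).all fun s => IntArc.avoidCheck (layerVertex i) s

/-- Fifteen vertices suffice: 15 to 19 belong to the next level and are covered by the separation of
levels. -/
lemma avoidsCheck_layerArcs_outerArcs : avoidsCheck 15 (layerArcs ++ outerArcs) = true := by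
  decide +kernel

lemma avoidsCheck_innerArcs : avoidsCheck 5 innerArcs = true := by
  decide +kernel

/-- Certificate that arcs run in the outer pentagon. -/
def insideCheck (l : List IntArc) : Bool :=
  l.all fun a => (a.corners layerVertex).all fun z =>
    pentagonSides.all fun ℓ => decide (ℓ.linear z ≤ ℓ.2)

lemma insideCheck_arcs : insideCheck (layerArcs ++ innerArcs) = true := by
  decide +kernel

/-- Certificate that a segment of an arc meets the inner pentagon in endpoints of the arc only. -/
def outsideSegmentCheck (a : IntArc) (s : IntPoint × IntPoint) : Bool :=
  pentagonSides.any fun ℓ =>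
    decide (ℓ.2 ≤ -10 * ℓ.linear s.1) && decide (ℓ.2 ≤ -10 * ℓ.linear s.2) &&
    (decide (ℓ.2 < -10 * ℓ.linear s.1) || a.isEnd layerVertex s.1) &&
    (decide (ℓ.2 < -10 * ℓ.linear s.2) || a.isEnd layerVertex s.2) &&
    (decide (ℓ.2 < -10 * ℓ.linear s.1) || decide (ℓ.2 < -10 * ℓ.linear s.2))

/-- For each segment, one side of the inner pentagon has the segment in its closed outer half-plane,
touching the line at most in one endpoint of the arc. A side of the inner pentagon would fail, which
is why those sides are left to the next level. -/
lemma outsideSegmentCheck_arcs : ((layerArcs ++ outerArcs).all fun a =>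
    (a.segments layerVertex).all fun s => outsideSegmentCheck a s) = true := by
  decide +kernel

lemma layerVertex_outside : ((List.range 15).all fun i =>
    pentagonSides.any fun ℓ => decide (ℓ.2 < -10 * ℓ.linear (layerVertex i))) = true := by
  decide +kernel

lemma layerVertex_inside : ((List.range 15).all fun i =>
    pentagonSides.all fun ℓ => decide (ℓ.linear (layerVertex i) ≤ ℓ.2)) = true := by
  decide +kernel

/-- The sign is negative because the inner pentagon of a plane dodecahedron is turned against the
outer one by a tenth of a turn, which for a nearly regular pentagon amounts to a half turn. -/
lemma layerVertex_inner : ((List.range 5).all fun i =>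
    layerVertex i == -10 • layerVertex (15 + i)) = true := by
  decide +kernel

lemma layerVertex_nodup : ((List.range 15).map layerVertex).Nodup := by
  decide +kernel

/-- The endpoints of the arcs of a list. -/
def endpoints (l : List IntArc) : List (ℕ × ℕ) := l.map fun a => (a.src, a.tgt)

lemma endpoints_layerArcs_outerArcs_nodup : (endpoints (layerArcs ++ outerArcs)).Nodup := by
  decide +kernel

lemma endpoints_innerArcs_nodup : (endpoints innerArcs).Nodup := by
  decide +kernel

lemma endpoints_layerArcs_outerArcs_lt : ((layerArcs ++ outerArcs).all fun a =>
    decide (a.src < 15 ∧ a.src < a.tgt ∧ a.tgt < 20)) = true := by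
  decide +kernel

lemma endpoints_innerArcs_lt : (innerArcs.all fun a =>
    decide (a.src < a.tgt ∧ a.tgt < 5)) = true := by
  decide +kernel

/-! ### Nested pentagons -/

/-- The points in the outer pentagon of the outermost layer. -/
def InPentagon (p : Plane) : Prop := ∀ ℓ ∈ pentagonSides, ℓ.linearR p ≤ ℓ.2

/-- The negative of each side form is bounded on the pentagon through the other sides, with ample
room for the factor 1/10. -/
lemma InPentagon.smul {p : Plane} (hp : InPentagon p) : InPentagon ((-1 / 10 : ℝ) • p) := by
  simp only [InPentagon, pentagonSides, List.forall_mem_cons, IntForm.linearR, List.not_mem_nil,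
    false_imp_iff, implies_true, and_true, PiLp.smul_apply, smul_eq_mul] at hp ⊢
  push_cast at hp ⊢
  obtain ⟨h1, h2, h3, h4, h5⟩ := hp
  refine ⟨?_, ?_, ?_, ?_, ?_⟩ <;> linarith

lemma InPentagon.pow_smul {p : Plane} (hp : InPentagon p) (m : ℕ) :
    InPentagon ((-1 / 10 : ℝ) ^ m • p) := by
  induction m with
  | zero => simpa using hp
  | succ m ih =>
    rw [pow_succ', mul_smul]
    exact ih.smul

lemma scale_ne_zero (k : ℕ) : ((-1 / 10 : ℝ)) ^ k ≠ 0 := pow_ne_zero _ (by norm_num)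

/-- Seen in the coordinates of layer `j`, everything in the pentagon of a deeper level `k` lies in
the inner pentagon, the set of `p` with `-10 • p` in the pentagon. -/
lemma inPentagon_of_smul_eq {j k : ℕ} (hjk : j < k) {p q : Plane}
    (h : (-1 / 10 : ℝ) ^ j • p = (-1 / 10 : ℝ) ^ k • q) (hq : InPentagon q) :
    InPentagon ((-10 : ℝ) • p) := by
  obtain ⟨m, rfl⟩ := Nat.exists_eq_add_of_lt hjk
  have hp : p = (-1 / 10 : ℝ) ^ (m + 1) • q := by
    apply smul_right_injective _ (scale_ne_zero j)
    simp only
    rw [h, smul_smul, ← pow_add, add_assoc]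
  have : (-10 : ℝ) • p = (-1 / 10 : ℝ) ^ m • q := by
    rw [hp, smul_smul, pow_succ]
    congr 1
    ring
  rw [this]
  exact hq.pow_smul m

lemma inPentagon_of_mem_segment {a : IntArc} (ha : a ∈ layerArcs ++ innerArcs)
    {s : IntPoint × IntPoint} (hs : s ∈ a.segments layerVertex) {p : Plane}
    (hp : p ∈ segment ℝ s.1.toPlane s.2.toPlane) : InPentagon p := by
  intro ℓ hℓ
  have h := insideCheck_arcs
  simp only [insideCheck, List.all_eq_true, decide_eq_true_eq] at h
  have hs' := List.of_mem_zip (show (s.1, s.2) ∈ _ from hs)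
  have h1 : (ℓ.linear s.1 : ℝ) ≤ ℓ.2 := by exact_mod_cast h a ha _ hs'.1 ℓ hℓ
  have h2 : (ℓ.linear s.2 : ℝ) ≤ ℓ.2 := by
    exact_mod_cast h a ha _ (List.mem_of_mem_tail hs'.2) ℓ hℓ
  obtain ⟨θ, h0, h1', e, -⟩ := ℓ.linearR_of_mem_segment hp
  rw [e]
  nlinarith [mul_nonneg h0 (sub_nonneg.2 h2), mul_nonneg (sub_nonneg.2 h1') (sub_nonneg.2 h1)]

lemma eq_end_of_mem_segment {a : IntArc} (ha : a ∈ layerArcs ++ outerArcs)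
    {s : IntPoint × IntPoint} (hs : s ∈ a.segments layerVertex) {p : Plane}
    (hp : p ∈ segment ℝ s.1.toPlane s.2.toPlane) (hin : InPentagon ((-10 : ℝ) • p)) :
    p = (layerVertex a.src).toPlane ∨ p = (layerVertex a.tgt).toPlane := by
  have h := outsideSegmentCheck_arcs
  simp only [List.all_eq_true] at h
  have h := h a ha s hs
  simp only [outsideSegmentCheck, List.any_eq_true, Bool.and_eq_true, Bool.or_eq_true,
    decide_eq_true_eq] at h
  obtain ⟨ℓ, hℓ, ⟨⟨⟨h1, h2⟩, h3⟩, h4⟩, h5⟩ := h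
  have key : ∀ z : IntPoint, a.isEnd layerVertex z = true → p = z.toPlane →
      p = (layerVertex a.src).toPlane ∨ p = (layerVertex a.tgt).toPlane := by
    intro v hv e
    rcases IntArc.isEnd_iff.1 hv with rfl | rfl
    · exact Or.inl e
    · exact Or.inr e
  have hin := hin ℓ hℓ
  rw [IntForm.linearR_smul] at hin
  have h1' : (ℓ.2 : ℝ) ≤ -10 * ℓ.linear s.1 := by exact_mod_cast h1
  have h2' : (ℓ.2 : ℝ) ≤ -10 * ℓ.linear s.2 := by exact_mod_cast h2
  have end_of : ∀ z w : IntPoint, p ∈ segment ℝ z.toPlane w.toPlane →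
      (ℓ.2 : ℝ) ≤ -10 * ℓ.linear z → ℓ.2 < -10 * ℓ.linear w → p = z.toPlane := by
    intro z w hp hz hw
    have hw' : (ℓ.2 : ℝ) < -10 * ℓ.linear w := by exact_mod_cast hw
    obtain ⟨θ, h0, h1', e, hθ⟩ := ℓ.linearR_of_mem_segment hp
    apply hθ
    rw [e] at hin
    by_contra hne
    -- For θ > 0 the strict inequality at `w` puts `p` strictly outside the side `ℓ` of the inner
    -- pentagon.
    nlinarith [mul_pos (h0.lt_of_ne' hne) (sub_pos.2 hw'),
      mul_nonneg (sub_nonneg.2 h1') (sub_nonneg.2 hz)]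
  rcases h4 with h4 | h4
  · have hp1 := end_of _ _ hp h1' h4
    rcases h3 with h3 | h3
    · rw [segment_symm] at hp
      have hp2 := end_of _ _ hp h2' h3
      rw [hp1, IntForm.linearR_toPlane] at hin
      have h3' : (ℓ.2 : ℝ) < -10 * ℓ.linear s.1 := by exact_mod_cast h3
      linarith
    · exact key _ h3 hp1
  · rcases h5 with h5 | h5
    · rw [segment_symm] at hp
      exact key _ h4 (end_of _ _ hp h2' h5)
    · have hp1 := end_of _ _ hp h1' h5
      rcases h3 with h3 | h3
      · rw [segment_symm] at hp
        exact key _ h4 (end_of _ _ hp h2' h3)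
      · exact key _ h3 hp1

lemma not_inPentagon_layerVertex {i : ℕ} (hi : i < 15) :
    ¬ InPentagon ((-10 : ℝ) • (layerVertex i).toPlane) := by
  intro h
  have h' := layerVertex_outside
  simp only [List.all_eq_true, List.any_eq_true, decide_eq_true_eq, List.mem_range] at h'
  obtain ⟨ℓ, hℓ, hlt⟩ := h' i hi
  have hle := h ℓ hℓ
  rw [IntForm.linearR_smul, IntForm.linearR_toPlane] at hle
  have hlt' : (ℓ.2 : ℝ) < -10 * ℓ.linear (layerVertex i) := by exact_mod_cast hlt
  linarith

lemma inPentagon_layerVertex {i : ℕ} (hi : i < 15) : InPentagon (layerVertex i).toPlane := by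
  intro ℓ hℓ
  have h' := layerVertex_inside
  simp only [List.all_eq_true, decide_eq_true_eq, List.mem_range] at h'
  rw [IntForm.linearR_toPlane]
  exact_mod_cast h' i hi ℓ hℓ

/-! ### The vertices of the tower of layers -/

/-- The position of a vertex in the infinite tower of layers. -/
noncomputable def towerVertex (i : ℕ) : Plane :=
  (-1 / 10 : ℝ) ^ (i / 15) • (layerVertex (i % 15)).toPlane

/-- Layers are glued here: vertices 15 to 19 of layer `k` are vertices 0 to 4 of layer `k + 1`. -/
lemma towerVertex_add (k : ℕ) {u : ℕ} (hu : u < 20) :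
    towerVertex (15 * k + u) = (-1 / 10 : ℝ) ^ k • (layerVertex u).toPlane := by
  rcases lt_or_ge u 15 with h | h
  · rw [towerVertex, Nat.mul_add_div (by norm_num), Nat.mul_add_mod, Nat.div_eq_of_lt h,
      Nat.mod_eq_of_lt h, add_zero]
  · obtain ⟨i, rfl⟩ := Nat.exists_eq_add_of_le h
    have hi : i < 5 := by omega
    have h' := layerVertex_inner
    simp only [List.all_eq_true, beq_iff_eq, List.mem_range] at h'
    have h' := h' i hi
    have e1 : (15 * k + (15 + i)) / 15 = k + 1 := by omega
    have e2 : (15 * k + (15 + i)) % 15 = i := by omega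
    rw [towerVertex, e1, e2, pow_succ, mul_smul, h']
    congr 1
    ext j
    fin_cases j <;> simp [toPlane] <;> ring

lemma towerVertex_injective : Function.Injective towerVertex := by
  -- A deeper vertex lies in the inner pentagon of every earlier layer, whereas the first 15
  -- vertices of a layer lie outside it.
  have aux : ∀ i j : ℕ, i / 15 < j / 15 → towerVertex i ≠ towerVertex j := by
    intro i j hij h
    exact not_inPentagon_layerVertex (Nat.mod_lt i (by norm_num))
      (inPentagon_of_smul_eq hij h (inPentagon_layerVertex (Nat.mod_lt j (by norm_num))))
  intro i j h
  rcases lt_trichotomy (i / 15) (j / 15) with hij | hij | hij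
  · exact absurd h (aux i j hij)
  · rw [towerVertex, towerVertex, hij] at h
    have h := toPlane_injective (smul_right_injective _ (scale_ne_zero _) h)
    have hmod := List.inj_on_of_nodup_map layerVertex_nodup
      (List.mem_range.2 (Nat.mod_lt i (by norm_num)))
      (List.mem_range.2 (Nat.mod_lt j (by norm_num))) h
    omega
  · exact absurd h.symm (aux j i hij)

/-! ### The edges of the tower with `N` layers -/

/-- The arcs of level `k` in the tower with `N` layers. -/
def arcsAt (N k : ℕ) : List IntArc :=
  if k = N then innerArcs else if k = 0 then layerArcs ++ outerArcs else layerArcs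

lemma mem_layerArcs_outerArcs {N k : ℕ} (hk : k < N) {a : IntArc} (ha : a ∈ arcsAt N k) :
    a ∈ layerArcs ++ outerArcs := by
  rw [arcsAt, if_neg hk.ne] at ha
  split_ifs at ha
  · exact ha
  · exact List.mem_append_left _ ha

lemma mem_layerArcs_innerArcs {N k : ℕ} (hk : 0 < k) {a : IntArc} (ha : a ∈ arcsAt N k) :
    a ∈ layerArcs ++ innerArcs := by
  rw [arcsAt, if_neg hk.ne'] at ha
  split_ifs at ha
  · exact List.mem_append_right _ ha
  · exact List.mem_append_left _ ha

lemma mem_all_arcs {N k : ℕ} {a : IntArc} (ha : a ∈ arcsAt N k) :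
    a ∈ layerArcs ++ outerArcs ++ innerArcs := by
  rw [arcsAt] at ha
  split_ifs at ha <;> simp only [List.mem_append] at ha ⊢ <;> tauto

lemma arcsAt_bounds {N k : ℕ} (hk : k ≤ N) {a : IntArc} (ha : a ∈ arcsAt N k) :
    a.src < 15 ∧ a.src < a.tgt ∧ a.tgt < 20 ∧ 15 * k + a.tgt < 15 * N + 5 := by
  rcases hk.lt_or_eq with h | rfl
  · have := endpoints_layerArcs_outerArcs_lt
    simp only [List.all_eq_true, decide_eq_true_eq] at this
    have := this a (mem_layerArcs_outerArcs h ha)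
    omega
  · have := endpoints_innerArcs_lt
    simp only [List.all_eq_true, decide_eq_true_eq] at this
    rw [arcsAt, if_pos rfl] at ha
    have := this a ha
    omega

lemma arcsAt_pairwise (N k : ℕ) : (arcsAt N k).Pairwise fun a b =>
    ∀ s ∈ a.segments layerVertex, ∀ t ∈ b.segments layerVertex, a.MeetRight layerVertex s t := by
  have h := IntArc.meetRight_of_pairsCheck pairsCheck_layerArcs_outerArcs
  rw [arcsAt]
  split_ifs
  · exact IntArc.meetRight_of_pairsCheck pairsCheck_innerArcs
  · exact h
  · exact (List.pairwise_append.1 h).1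

lemma endpoints_arcsAt_nodup (N k : ℕ) : (endpoints (arcsAt N k)).Nodup := by
  have h := endpoints_layerArcs_outerArcs_nodup
  rw [arcsAt]
  split_ifs
  · exact endpoints_innerArcs_nodup
  · exact h
  · rw [endpoints, List.map_append] at h
    exact h.of_append_left

/-- The edges of the tower as pairs of natural numbers. -/
def towerEdges (N : ℕ) : Set (Sym2 ℕ) :=
  {e | ∃ k ≤ N, ∃ a ∈ arcsAt N k, e = s(15 * k + a.src, 15 * k + a.tgt)}

lemma ncard_towerEdges {N : ℕ} (hN : 0 < N) : (towerEdges N).ncard = 75 * N + 15 := by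
  let F : Finset (Σ _ : ℕ, ℕ × ℕ) :=
    (Finset.range (N + 1)).sigma fun k => (endpoints (arcsAt N k)).toFinset
  let g : (Σ _ : ℕ, ℕ × ℕ) → Sym2 ℕ := fun x => s(15 * x.1 + x.2.1, 15 * x.1 + x.2.2)
  have hF : ∀ x ∈ F, x.2.1 < 15 ∧ x.2.1 < x.2.2 := by
    rintro ⟨k, u, v⟩ hx
    simp only [F, Finset.mem_sigma, Finset.mem_range, List.mem_toFinset, endpoints,
      List.mem_map, Prod.mk.injEq] at hx
    obtain ⟨hk, a, ha, rfl, rfl⟩ := hx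
    have := arcsAt_bounds (Nat.lt_succ_iff.1 hk) ha
    exact ⟨this.1, this.2.1⟩
  have himage : towerEdges N = g '' F := by
    ext e
    simp only [towerEdges, Set.mem_ofPred_eq, Set.mem_image, Finset.mem_coe, F, Finset.mem_sigma,
      Finset.mem_range, List.mem_toFinset, endpoints, List.mem_map, Sigma.exists, Prod.exists,
      Prod.mk.injEq, g, Nat.lt_succ_iff]
    constructor
    · rintro ⟨k, hk, a, ha, rfl⟩
      exact ⟨k, a.src, a.tgt, ⟨hk, a, ha, rfl, rfl⟩, rfl⟩
    · rintro ⟨k, _, _, ⟨hk, a, ha, rfl, rfl⟩, rfl⟩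
      exact ⟨k, hk, a, ha, rfl⟩
  -- Since `src < tgt` and `src < 15`, the smaller endpoint of the edge determines both the level
  -- and `src`.
  have hinj : Set.InjOn g F := by
    rintro ⟨k, u, v⟩ hx ⟨k', u', v'⟩ hy h
    have h1 := hF _ hx
    have h2 := hF _ hy
    simp only [g, Sym2.eq_iff] at h h1 h2
    have : k = k' := by omega
    subst this
    have hu : u = u' := by omega
    have hv : v = v' := by omega
    rw [hu, hv]
  rw [himage, hinj.ncard_image, Set.ncard_coe_finset, Finset.card_sigma, Finset.sum_range_succ]
  have hcard : ∀ k, (endpoints (arcsAt N k)).toFinset.card = (arcsAt N k).length := by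
    intro k
    rw [List.toFinset_card_of_nodup (endpoints_arcsAt_nodup N k), endpoints, List.length_map]
  simp only [hcard]
  -- With N = M + 1, the levels contribute 80 (level 0), then 75 each (M levels), then 10 (level N).
  obtain ⟨M, rfl⟩ := Nat.exists_eq_add_of_lt hN
  rw [zero_add, Finset.sum_range_succ']
  have h1 : ∀ k ∈ Finset.range M, (arcsAt (M + 1) (k + 1)).length = 75 := by
    intro k hk
    have hk := Finset.mem_range.1 hk
    rw [arcsAt, if_neg (by omega), if_neg (by omega)]
    rfl
  have h2 : (arcsAt (M + 1) 0).length = 80 := by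
    rw [arcsAt, if_neg (by omega), if_pos rfl]
    rfl
  have h3 : (arcsAt (M + 1) (M + 1)).length = 10 := by
    rw [arcsAt, if_pos rfl]
    rfl
  rw [Finset.sum_congr rfl h1, h2, h3, Finset.sum_const, Finset.card_range, smul_eq_mul]
  ring

/-! ### The drawing of the tower -/

/-- The corners of an arc of level `k`. -/
noncomputable def towerChain (k : ℕ) (a : IntArc) : List Plane :=
  ((a.corners layerVertex).map toPlane).map ((-1 / 10 : ℝ) ^ k • ·)

lemma mem_chainSegments_towerChain {k : ℕ} {a : IntArc} {s : Plane × Plane}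
    (hs : s ∈ chainSegments (towerChain k a)) : ∃ t ∈ a.segments layerVertex,
      s = ((-1 / 10 : ℝ) ^ k • t.1.toPlane, (-1 / 10 : ℝ) ^ k • t.2.toPlane) := by
  rw [towerChain, chainSegments_map, IntArc.chainSegments_corners, List.map_map,
    List.mem_map] at hs
  obtain ⟨t, ht, rfl⟩ := hs
  exact ⟨t, ht, rfl⟩

lemma towerChain_eq {N k : ℕ} (hk : k ≤ N) {a : IntArc} (ha : a ∈ arcsAt N k) :
    ∃ bends : List Plane, towerChain k a =
      towerVertex (15 * k + a.src) :: (bends ++ [towerVertex (15 * k + a.tgt)]) := by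
  have h := arcsAt_bounds hk ha
  refine ⟨(a.bends.map toPlane).map ((-1 / 10 : ℝ) ^ k • ·), ?_⟩
  rw [towerVertex_add k (h.1.trans (by norm_num)), towerVertex_add k h.2.2.1]
  simp [towerChain, IntArc.corners]

lemma towerChain_simple {N k : ℕ} {a : IntArc} (ha : a ∈ arcsAt N k) :
    IsSimpleChain (towerChain k a) ∧ (towerChain k a).length ≤ 3 := by
  have h := simpleCheck_arcs
  simp only [List.all_eq_true] at h
  have h := IntArc.isSimpleChain_of_simpleCheck (h a (mem_all_arcs ha))
  exact ⟨h.1.smul (scale_ne_zero k), by simpa [towerChain] using h.2⟩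

/-- Arcs of different levels meet only in endpoints of the outer arc. -/
lemma towerChain_levels {N j k : ℕ} (hjk : j < k) (hk : k ≤ N) {a b : IntArc}
    (ha : a ∈ arcsAt N j) (hb : b ∈ arcsAt N k) {s t : Plane × Plane}
    (hs : s ∈ chainSegments (towerChain j a)) (ht : t ∈ chainSegments (towerChain k b))
    {p : Plane} (hp : p ∈ segment ℝ s.1 s.2) (hq : p ∈ segment ℝ t.1 t.2) :
    p = towerVertex (15 * j + a.src) ∨ p = towerVertex (15 * j + a.tgt) := by
  obtain ⟨s, hs', rfl⟩ := mem_chainSegments_towerChain hs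
  obtain ⟨t, ht', rfl⟩ := mem_chainSegments_towerChain ht
  obtain ⟨x, hx, rfl⟩ := exists_smul_of_mem_segment_smul hp
  obtain ⟨y, hy, e⟩ := exists_smul_of_mem_segment_smul hq
  have hin := inPentagon_of_smul_eq hjk e
    (inPentagon_of_mem_segment (mem_layerArcs_innerArcs (by omega) hb) ht' hy)
  have h := arcsAt_bounds (hjk.le.trans hk) ha
  rw [towerVertex_add j (h.1.trans (by norm_num)), towerVertex_add j h.2.2.1]
  exact (eq_end_of_mem_segment (mem_layerArcs_outerArcs (hjk.trans_le hk) ha) hs' hx hin).imp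
    (congrArg _) (congrArg _)

lemma towerChain_avoids {N k : ℕ} (hk : k ≤ N) {a : IntArc} (ha : a ∈ arcsAt N k)
    {s : Plane × Plane} (hs : s ∈ chainSegments (towerChain k a)) {i : ℕ} (hi : i < 15 * N + 5)
    (hp : towerVertex i ∈ segment ℝ s.1 s.2) : i = 15 * k + a.src ∨ i = 15 * k + a.tgt := by
  obtain ⟨s, hs', rfl⟩ := mem_chainSegments_towerChain hs
  obtain ⟨x, hx, e⟩ := exists_smul_of_mem_segment_smul hp
  have hi15 : i % 15 < 15 := Nat.mod_lt i (by norm_num)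
  have hb := arcsAt_bounds hk ha
  rcases lt_trichotomy k (i / 15) with hki | hki | hki
  -- A vertex of a deeper level lies in the inner pentagon of layer `k`, where the arc has only its
  -- endpoints.
  · have hin := inPentagon_of_smul_eq hki e.symm (inPentagon_layerVertex hi15)
    have h := eq_end_of_mem_segment (mem_layerArcs_outerArcs (by omega) ha) hs' hx hin
    refine h.imp (fun h => towerVertex_injective ?_) (fun h => towerVertex_injective ?_)
    · rw [e, h, towerVertex_add k (by omega)]
    · rw [e, h, towerVertex_add k (by omega)]
  · rw [towerVertex, ← hki] at e
    obtain rfl := smul_right_injective _ (scale_ne_zero _) e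
    by_contra hne
    have hmod : i % 15 ≠ a.src ∧ i % 15 ≠ a.tgt := by omega
    have key : IntArc.avoidCheck (layerVertex (i % 15)) s = true := by
      rcases hk.lt_or_eq with h | rfl
      · have h' := avoidsCheck_layerArcs_outerArcs
        simp only [avoidsCheck, List.all_eq_true, List.mem_range, Bool.or_eq_true,
          beq_iff_eq] at h'
        exact (h' a (mem_layerArcs_outerArcs h ha) _ hi15).resolve_left (by tauto) s hs'
      · have h' := avoidsCheck_innerArcs
        simp only [avoidsCheck, List.all_eq_true, List.mem_range, Bool.or_eq_true,
          beq_iff_eq] at h'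
        rw [arcsAt, if_pos rfl] at ha
        -- At level N only the vertices 0 to 4 exist, by the bound on `i`.
        exact (h' a ha _ (by omega)).resolve_left (by tauto) s hs'
    exact IntArc.not_mem_segment_of_avoidCheck key hx
  -- A vertex of an earlier level would lie in the inner pentagon of its own layer, which contains
  -- none of its first 15 vertices.
  · exact absurd (inPentagon_of_smul_eq hki e
      (inPentagon_of_mem_segment (mem_layerArcs_innerArcs (by omega) ha) hs' hx))
      (not_inPentagon_layerVertex hi15)

/-- Arcs of the same level meet in endpoints or at right angles. -/
lemma towerChain_meet {N k : ℕ} (hk : k ≤ N) {a b : IntArc} (hab : a ≠ b)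
    (ha : a ∈ arcsAt N k) (hb : b ∈ arcsAt N k) {s t : Plane × Plane}
    (hs : s ∈ chainSegments (towerChain k a)) (ht : t ∈ chainSegments (towerChain k b))
    {p : Plane} (hp : p ∈ segment ℝ s.1 s.2) (hq : p ∈ segment ℝ t.1 t.2)
    (hv : ∀ i < 15 * N + 5, p ≠ towerVertex i) :
    p ∈ openSegment ℝ s.1 s.2 ∧ p ∈ openSegment ℝ t.1 t.2 ∧
      inner ℝ (s.2 - s.1) (t.2 - t.1) = 0 := by
  obtain ⟨s, hs', rfl⟩ := mem_chainSegments_towerChain hs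
  obtain ⟨t, ht', rfl⟩ := mem_chainSegments_towerChain ht
  obtain ⟨x, hx, rfl⟩ := exists_smul_of_mem_segment_smul hp
  obtain ⟨y, hy, e⟩ := exists_smul_of_mem_segment_smul hq
  obtain rfl := smul_right_injective _ (scale_ne_zero k) e
  have vertex_ne : ∀ c ∈ arcsAt N k,
      ¬ (x = (layerVertex c.src).toPlane ∨ x = (layerVertex c.tgt).toPlane) := by
    rintro c hc (rfl | rfl)
    · have h := arcsAt_bounds hk hc
      exact hv (15 * k + c.src) (by omega) (towerVertex_add k (by omega)).symm
    · have h := arcsAt_bounds hk hc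
      exact hv (15 * k + c.tgt) (by omega) (towerVertex_add k (by omega)).symm
  have h : x ∈ openSegment ℝ s.1.toPlane s.2.toPlane ∧ x ∈ openSegment ℝ t.1.toPlane t.2.toPlane ∧
      inner ℝ (s.2.toPlane - s.1.toPlane) (t.2.toPlane - t.1.toPlane) = 0 := by
    -- The certificate covers pairs in list order and `MeetRight` singles out the first arc;
    -- symmetrizing makes it available for any two distinct arcs.
    let R : IntArc → IntArc → Prop := fun a b =>
      (∀ s ∈ a.segments layerVertex, ∀ t ∈ b.segments layerVertex, a.MeetRight layerVertex s t) ∨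
      (∀ t ∈ b.segments layerVertex, ∀ s ∈ a.segments layerVertex, b.MeetRight layerVertex t s)
    have : Std.Symm R := ⟨fun _ _ h => h.symm⟩
    have hR : (arcsAt N k).Pairwise R := (arcsAt_pairwise N k).imp Or.inl
    rcases hR.forall ha hb hab with h | h
    · exact (h s hs' t ht' x hx hy).resolve_left (vertex_ne a ha)
    · obtain ⟨h1, h2, h3⟩ := (h t ht' s hs' x hy hx).resolve_left (vertex_ne b hb)
      exact ⟨h2, h1, by rw [real_inner_comm]; exact h3⟩
  obtain ⟨h1, h2, h3⟩ := h
  refine ⟨smul_mem_openSegment h1, smul_mem_openSegment h2, ?_⟩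
  rw [← smul_sub, ← smul_sub, inner_smul_left, inner_smul_right, h3, mul_zero, mul_zero]

/-- The graph of the tower with `N` layers. -/
def towerGraph (N : ℕ) : SimpleGraph (Fin (15 * N + 5)) :=
  SimpleGraph.fromEdgeSet {e | e.map Fin.val ∈ towerEdges N}

/-- `fromEdgeSet` discards loops, but there are none, since `src < tgt` for every arc. -/
lemma mem_edgeSet_towerGraph {N : ℕ} {e : Sym2 (Fin (15 * N + 5))} :
    e ∈ (towerGraph N).edgeSet ↔ e.map Fin.val ∈ towerEdges N := by
  rw [towerGraph, SimpleGraph.edgeSet_fromEdgeSet]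
  refine ⟨fun h => h.1, fun h => ⟨h, ?_⟩⟩
  obtain ⟨k, hk, a, ha, h⟩ := h
  have hb := arcsAt_bounds hk ha
  induction e with
  | _ x y =>
    rintro hxy
    have hxy : x = y := by simpa using hxy
    subst hxy
    simp only [Sym2.map_mk, Sym2.eq_iff] at h
    omega

lemma ncard_edgeSet_towerGraph {N : ℕ} (hN : 0 < N) :
    (towerGraph N).edgeSet.ncard = 75 * N + 15 := by
  rw [← ncard_towerEdges hN,
    ← Set.ncard_image_of_injective _ (Sym2.map.injective (Fin.val_injective (n := 15 * N + 5)))]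
  congr 1
  ext e
  constructor
  · rintro ⟨e, he, rfl⟩
    exact mem_edgeSet_towerGraph.1 he
  · intro he
    obtain ⟨k, hk, a, ha, rfl⟩ := id he
    have hb := arcsAt_bounds hk ha
    exact ⟨s(⟨15 * k + a.src, by omega⟩, ⟨15 * k + a.tgt, by omega⟩),
      mem_edgeSet_towerGraph.2 he, rfl⟩

lemma isRACGraph_towerGraph (N : ℕ) : IsRACGraph 1 (towerGraph N) := by
  have hdata : ∀ e : (towerGraph N).edgeSet, ∃ (k : ℕ) (a : IntArc), k ≤ N ∧ a ∈ arcsAt N k ∧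
      (e : Sym2 (Fin (15 * N + 5))).map Fin.val = s(15 * k + a.src, 15 * k + a.tgt) := by
    intro e
    obtain ⟨k, hk, a, ha, h⟩ := mem_edgeSet_towerGraph.1 e.2
    exact ⟨k, a, hk, ha, h⟩
  choose k a hk ha he using hdata
  let pos : Fin (15 * N + 5) → Plane := fun i => towerVertex i
  have mem_of_eq : ∀ (e : (towerGraph N).edgeSet) (w : Fin (15 * N + 5)),
      (w : ℕ) = 15 * k e + (a e).src ∨ (w : ℕ) = 15 * k e + (a e).tgt →
      w ∈ (e : Sym2 (Fin (15 * N + 5))) := by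
    intro e w hw
    have h : (w : ℕ) ∈ (e : Sym2 (Fin (15 * N + 5))).map Fin.val := by
      rw [he e, Sym2.mem_iff]
      exact hw
    obtain ⟨x, hx, hxw⟩ := Sym2.mem_map.1 h
    rwa [← Fin.val_injective hxw]
  let Γ : PolylineDrawing (towerGraph N) :=
    { pos := pos
      pos_injective := towerVertex_injective.comp Fin.val_injective
      chain := fun e => towerChain (k e) (a e)
      chain_joins := by
        intro e
        obtain ⟨bends, hbends⟩ := towerChain_eq (hk e) (ha e)
        have hb := arcsAt_bounds (hk e) (ha e)
        refine ⟨⟨15 * k e + (a e).src, by omega⟩, ⟨15 * k e + (a e).tgt, by omega⟩, bends, ?_,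
          hbends⟩
        exact Sym2.map.injective Fin.val_injective (he e)
      chain_simple := fun e => (towerChain_simple (ha e)).1
      chain_avoids := fun e w s hs hw =>
        mem_of_eq e w (towerChain_avoids (hk e) (ha e) hs w.2 hw) }
  refine ⟨Γ, fun e => (towerChain_simple (ha e)).2, ?_⟩
  intro e f hef s hs t ht p hp hq hv
  have hv' : ∀ i < 15 * N + 5, p ≠ towerVertex i := fun i hi => hv ⟨i, hi⟩
  have levels : ∀ e f : (towerGraph N).edgeSet, k e < k f →
      ∀ s ∈ chainSegments (towerChain (k e) (a e)), ∀ t ∈ chainSegments (towerChain (k f) (a f)),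
      p ∈ segment ℝ s.1 s.2 → p ∉ segment ℝ t.1 t.2 := by
    intro e f hlt s hs t ht hp hq
    have hb := arcsAt_bounds (hk e) (ha e)
    rcases towerChain_levels hlt (hk f) (ha e) (ha f) hs ht hp hq with h | h
    · exact hv' _ (by omega) h
    · exact hv' _ (by omega) h
  rcases lt_trichotomy (k e) (k f) with h | h | h
  · exact absurd hq (levels e f h s hs t ht hp)
  · have hab : a e ≠ a f := by
      intro hab
      apply hef
      apply Subtype.ext
      apply Sym2.map.injective Fin.val_injective
      rw [he e, he f, h, hab]
    have haf : a f ∈ arcsAt N (k e) := h ▸ ha f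
    have ht' : t ∈ chainSegments (towerChain (k e) (a f)) := h ▸ ht
    exact towerChain_meet (hk e) hab (ha e) haf hs ht' hp hq hv'
  · exact absurd hp (levels f e h t ht s hs hq)

theorem mainTheorem2 :
    {n : ℕ | ∃ G : SimpleGraph (Fin n),
      IsRACGraph 1 G ∧ (G.edgeSet.ncard : ℤ) = 5 * (n : ℤ) - 10}.Infinite := by
  -- The shift to `N + 1` ensures at least one layer: with none, `arcsAt` yields only the inner arcs
  -- and the edge count fails.
  refine Set.infinite_of_injective_forall_mem (f := fun N : ℕ => 15 * (N + 1) + 5) ?_ ?_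
  · intro M N h
    simpa using h
  · intro N
    refine ⟨towerGraph (N + 1), isRACGraph_towerGraph (N + 1), ?_⟩
    rw [ncard_edgeSet_towerGraph (Nat.succ_pos N)]
    push_cast
    ring
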